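/- Let $x_1,\dots,x_n\in[-1,1]^k$ be the rows of a design, let $\bar x_1,\dots,\bar x_q$ be the distinct values among them, listed without repetition, and suppose $q<n$. Let $Z$ be the $n\times q$ matrix with $Z_{ij}=1$ if $x_i=\bar x_j$ and $Z_{ij}=0$ otherwise, and put $H_Z=Z(Z^{\mathsf T}Z)^{-1}Z^{\mathsf T}$. Let $f:[-1,1]^k\to\mathbb R^p$ be a regression function, let $F$ be the $n\times p$ matrix with $i$th row $f(x_i)^{\mathsf T}$, and suppose that $F^{\mathsf T}F$ is invertible. Let $\mu:[-1,1]^k\to\mathbb R$ be any function, $\boldsymbol\mu=(\mu(x_1),\dots,\mu(x_n))^{\mathsf T}$, $\bar{\boldsymbol\mu}=(\mu(\bar x_1),\dots,\mu(\bar x_q))^{\mathsf T}$, and let $\kappa>0$. Let $y\sim N(Z\bar{\boldsymbol\mu},\kappa I_n)$, let $$\tilde\sigma^2=\frac{1}{n-q}\,y^{\mathsf T}(I_n-H_Z)y,\qquad w=\frac1{2\tilde\sigma^2},$$ and for $t\in\mathbb R^p$ consider the expected weighted sum-of-squares loss $$L(t)=\mathrm E\Big[w\sum_{i=1}^n\big(y_i-f(x_i)^{\mathsf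 T}t\big)^2\Big]\in[0,\infty].$$ The target parameter values are the minimisers of $L$ over $\mathbb R^p$. Then $\theta=(F^{\mathsf T}F)^{-1}F^{\mathsf T}\boldsymbol\mu$ is a minimiser of $L$. If moreover $n-q>2$, then $L(t)<\infty$ for every $t\in\mathbb R^p$ and $\theta$ is the only minimiser of $L$. -/

import Mathlib

open MeasureTheory ProbabilityTheory Matrix
open scoped ENNReal

noncomputable section

namespace GibbsDesign

/-- The space `[-1,1]^k` of values of the controllable variables. -/
abbrev Treatment (k : ℕ) : Type := Set.Icc (-1 : Fin k → ℝ) 1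

/-- The rows `xbar 1, …, xbar q` list, without repetition, the distinct values among the
rows `x 1, …, x n` of the design. -/
structure IsUniqueTreatments {k n q : ℕ} (x : Fin n → Treatment k) (xbar : Fin q → Treatment k) :
    Prop where
  injective : Function.Injective xbar
  range_eq : Set.range xbar = Set.range x

/-- The `n × p` model matrix `F`, whose `i`th row is `f (x i)`. -/
def modelMatrix {k n p : ℕ} (f : Treatment k → Fin p → ℝ) (x : Fin n → Treatment k) :
    Matrix (Fin n) (Fin p) ℝ :=
  Matrix.of fun i j => f (x i) j

open Classical in
/-- The `n × q` model matrix `Z` of the unique-treatment model. -/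
def treatmentMatrix {k n q : ℕ} (x : Fin n → Treatment k) (xbar : Fin q → Treatment k) :
    Matrix (Fin n) (Fin q) ℝ :=
  Matrix.of fun i j => if x i = xbar j then 1 else 0

/-- The hat matrix `H_A = A (Aᵀ A)⁻¹ Aᵀ`. -/
def hatMatrix {n m : ℕ} (A : Matrix (Fin n) (Fin m) ℝ) : Matrix (Fin n) (Fin n) ℝ :=
  A * (Aᵀ * A)⁻¹ * Aᵀ

/-- The estimate `yᵀ (I - H_Z) y / (n - q)` of the error variance under the
unique-treatment model. -/
def pureErrorVariance {k n q : ℕ} (x : Fin n → Treatment k) (xbar : Fin q → Treatment k)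
    (y : EuclideanSpace ℝ (Fin n)) : ℝ :=
  (1 / ((n : ℝ) - (q : ℝ))) *
    (y.ofLp ⬝ᵥ ((1 - hatMatrix (treatmentMatrix x xbar)) *ᵥ y.ofLp))

/-- The calibration weight `w = 1 / (2 σ̃²)`. -/
def calibrationWeight {k n q : ℕ} (x : Fin n → Treatment k) (xbar : Fin q → Treatment k)
    (y : EuclideanSpace ℝ (Fin n)) : ℝ :=
  1 / (2 * pureErrorVariance x xbar y)

/-- The sum of squares loss `∑ i, (y i - f(x i)ᵀ t)²`. -/
def ssLoss {k n p : ℕ} (f : Treatment k → Fin p → ℝ) (x : Fin n → Treatment k)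
    (t : Fin p → ℝ) (y : EuclideanSpace ℝ (Fin n)) : ℝ :=
  ∑ i, (y i - f (x i) ⬝ᵥ t) ^ 2

/-- The designer distribution `N(Z μbar, κ I)`, where `μbar j = μ (xbar j)`. -/
def designerDistribution {k n q : ℕ} (x : Fin n → Treatment k) (xbar : Fin q → Treatment k)
    (μ : Treatment k → ℝ) (κ : ℝ) : Measure (EuclideanSpace ℝ (Fin n)) :=
  multivariateGaussian
    (WithLp.toLp 2 (treatmentMatrix x xbar *ᵥ fun j => μ (xbar j)))
    (κ • (1 : Matrix (Fin n) (Fin n) ℝ))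

/-- The expected loss `E_D [w(y) ℓ(t; y)]`, in `[0,∞]`, of a nonnegative weighted loss. -/
def expectedLoss {Y T : Type*} [MeasurableSpace Y] (D : Measure Y) (w : Y → ℝ)
    (loss : T → Y → ℝ) (t : T) : ℝ≥0∞ :=
  ∫⁻ y, ENNReal.ofReal (w y * loss t y) ∂D

/-- The set `arg min_t E_D [w(y) ℓ(t; y)]` of target parameter values. -/
def targetValues {Y T : Type*} [MeasurableSpace Y] (D : Measure Y) (w : Y → ℝ)
    (loss : T → Y → ℝ) : Set T :=
  {t | ∀ s, expectedLoss D w loss t ≤ expectedLoss D w loss s}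

/-- The projected mean `(Fᵀ F)⁻¹ Fᵀ m` of a mean vector `m`. -/
def projectedMean {n p : ℕ} (F : Matrix (Fin n) (Fin p) ℝ) (m : Fin n → ℝ) : Fin p → ℝ :=
  ((Fᵀ * F)⁻¹ * Fᵀ) *ᵥ m

/-- The quadratic form of `I - H_A` is nonnegative. -/
lemma quadForm_one_sub_hatMatrix_nonneg {n m : ℕ} (A : Matrix (Fin n) (Fin m) ℝ)
    (v : Fin n → ℝ) : 0 ≤ v ⬝ᵥ ((1 - hatMatrix A) *ᵥ v) := by
  have hsymm : (1 - hatMatrix A)ᵀ = 1 - hatMatrix A := by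
    simp [hatMatrix, Matrix.transpose_mul, Matrix.transpose_nonsing_inv, Matrix.mul_assoc]
  have hidem : hatMatrix A * hatMatrix A = hatMatrix A := by
    by_cases h : IsUnit (Aᵀ * A).det
    · have h1 : (Aᵀ * A)⁻¹ * (Aᵀ * A) = 1 := Matrix.nonsing_inv_mul _ h
      calc hatMatrix A * hatMatrix A
          = A * ((Aᵀ * A)⁻¹ * (Aᵀ * A)) * (Aᵀ * A)⁻¹ * Aᵀ := by
            simp only [hatMatrix, Matrix.mul_assoc]
        _ = hatMatrix A := by rw [h1, Matrix.mul_one, hatMatrix]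
    · simp [hatMatrix, Matrix.nonsing_inv_apply_not_isUnit _ h]
  have hM : 1 - hatMatrix A = (1 - hatMatrix A)ᵀ * (1 - hatMatrix A) := by
    rw [hsymm]
    simp [Matrix.sub_mul, Matrix.mul_sub, hidem]
  rw [hM, ← Matrix.mulVec_mulVec, Matrix.dotProduct_mulVec, Matrix.vecMul_transpose]
  exact Finset.sum_nonneg fun i _ => mul_self_nonneg _

/-- The weighted sum of squares loss is nonnegative, so that `expectedLoss` is its expectation. -/
lemma weighted_ssLoss_nonneg {k n p q : ℕ} (f : Treatment k → Fin p → ℝ)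
    (x : Fin n → Treatment k) (xbar : Fin q → Treatment k) (hq : q < n)
    (t : Fin p → ℝ) (y : EuclideanSpace ℝ (Fin n)) :
    0 ≤ calibrationWeight x xbar y * ssLoss f x t y := by
  have h1 : (0 : ℝ) ≤ (n : ℝ) - (q : ℝ) := by
    have : (q : ℝ) < n := by exact_mod_cast hq
    linarith
  have h2 := quadForm_one_sub_hatMatrix_nonneg (treatmentMatrix x xbar) y.ofLp
  have h3 : 0 ≤ pureErrorVariance x xbar y := mul_nonneg (one_div_nonneg.2 h1) h2
  exact mul_nonneg (one_div_nonneg.2 (by linarith)) (Finset.sum_nonneg fun i _ => sq_nonneg _)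

end GibbsDesign

end

/-!
Let `K` be the column space of the design matrix `A` and let `m ∈ K` be the mean of `y`. The weight
is a multiple of `‖P y‖⁻²`, where `P` is the orthogonal projection onto `Kᗮ`. The reflection in `Kᗮ`
about `m` sends `y - m` to `σ (y - m)`; it preserves the law of `y` and the weight, and `σ` negates
`m - b` for each `b ∈ K`. Averaging the weighted loss over this reflection, the parallelogram law
gives a bias-variance decomposition in `[0, ∞]`:
`E[w ‖y - b‖²] = E[w] ‖m - b‖² + E[w ‖y - m‖²]`.
With `b = F t`, only `‖m - F t‖` depends on `t`; least squares minimises it, uniquely if `F` is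
injective.
The constant `E[w]` is never zero, and both constants are finite as soon as `dim Kᗮ > 2`.
-/

open scoped NNReal

namespace GibbsDesign

section GaussianReal

lemma integrable_abs_rpow_gaussianReal {v : ℝ≥0} (hv : v ≠ 0) {r : ℝ} (hr : -1 < r) :
    Integrable (fun s : ℝ => |s| ^ r) (gaussianReal 0 v) := by
  have hv_pos : 0 < (2 * v : ℝ)⁻¹ := by positivity
  have h_volume : Integrable (fun s : ℝ => |s| ^ r * Real.exp (-(2 * v : ℝ)⁻¹ * |s| ^ 2)) := by
    refine (integrable_fun_norm_addHaar volume
      (f := fun s : ℝ => s ^ r * Real.exp (-(2 * v : ℝ)⁻¹ * s ^ 2))).2 ?_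
    simpa using integrableOn_rpow_mul_exp_neg_mul_sq hv_pos hr
  rw [gaussianReal_of_var_ne_zero _ hv, integrable_withDensity_iff (measurable_gaussianPDF _ _)
    (ae_of_all _ fun _ => ENNReal.ofReal_lt_top)]
  refine (h_volume.const_mul (√(2 * Real.pi * v))⁻¹).congr (ae_of_all _ fun s => ?_)
  simp only [toReal_gaussianPDF, gaussianPDFReal, sub_zero, sq_abs, div_eq_inv_mul, mul_neg,
    neg_mul]
  ring

lemma integrable_abs_rpow_mul_one_add_sq_pow_gaussianReal {v : ℝ≥0} (hv : v ≠ 0) (j : ℕ) {r : ℝ}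
    (hr : -1 < r) : Integrable (fun s : ℝ => |s| ^ r * (1 + s ^ 2) ^ j) (gaussianReal 0 v) := by
  induction j generalizing r with
  | zero => simpa using integrable_abs_rpow_gaussianReal hv hr
  | succ j ih =>
    refine ((ih hr).add (ih (r := r + (2 : ℕ)) (by push_cast; linarith))).congr
      (ae_of_all _ fun s => ?_)
    rw [Pi.add_apply, Real.rpow_add_natCast' (abs_nonneg s) (by push_cast; linarith), sq_abs]
    ring

lemma ae_pi_gaussianReal_ne_zero (ι : Type*) [Fintype ι] {v : ℝ≥0} (hv : v ≠ 0) :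
    ∀ᵐ c ∂(Measure.pi fun _ : ι => gaussianReal 0 v), ∀ i, c i ≠ 0 := by
  have := nullSingletonClass_gaussianReal (μ := 0) hv
  exact ae_all_iff.2 fun i =>
    (measurePreserving_eval (fun _ : ι => gaussianReal 0 v) i).quasiMeasurePreserving.ae
      (Measure.ae_ne _ 0)

end GaussianReal

lemma one_add_sum_sq_le_prod_one_add_sq {ι : Type*} (s : Finset ι) (c : ι → ℝ) :
    1 + ∑ i ∈ s, c i ^ 2 ≤ ∏ i ∈ s, (1 + c i ^ 2) := by
  classical
  induction s using Finset.induction_on with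
  | empty => simp
  | insert a s ha ih =>
    rw [Finset.sum_insert ha, Finset.prod_insert ha]
    have : 0 ≤ ∑ i ∈ s, c i ^ 2 := Finset.sum_nonneg fun i _ => sq_nonneg _
    nlinarith [sq_nonneg (c a)]

section InnerProductSpace

variable {E : Type*} [NormedAddCommGroup E] [InnerProductSpace ℝ E]

lemma starProjection_reflection (K : Submodule ℝ E) [K.HasOrthogonalProjection] (z : E) :
    K.starProjection (K.reflection z) = K.starProjection z := by
  rw [K.reflection_apply, map_sub, map_nsmul,
    K.starProjection_eq_self_iff.2 (K.starProjection_apply_mem z), two_smul, add_sub_cancel_right]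

lemma norm_sub_starProjection_lt (K : Submodule ℝ E) [K.HasOrthogonalProjection] {m b : E}
    (hb : b ∈ K) (hne : b ≠ K.starProjection m) : ‖m - K.starProjection m‖ < ‖m - b‖ := by
  have h_orthogonal : inner ℝ (m - K.starProjection m) (K.starProjection m - b) = 0 :=
    K.starProjection_inner_eq_zero m _ (K.sub_mem (K.starProjection_apply_mem m) hb)
  have h_pythagoras := norm_add_sq_eq_norm_sq_add_norm_sq_real h_orthogonal
  rw [sub_add_sub_cancel] at h_pythagoras
  have h_pos : 0 < ‖K.starProjection m - b‖ := norm_sub_pos_iff.2 hne.symm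
  nlinarith [norm_nonneg (m - b), norm_nonneg (m - K.starProjection m)]

lemma enorm_add_sq_add_enorm_sub_sq (a z : E) :
    ‖a + z‖ₑ ^ 2 + ‖a - z‖ₑ ^ 2 = 2 * (‖a‖ₑ ^ 2 + ‖z‖ₑ ^ 2) := by
  simp only [enorm, sq]
  exact_mod_cast parallelogram_law_with_nnnorm_mul ℝ a z

lemma lintegral_mul_enorm_sub_sq [MeasurableSpace E] [BorelSpace E] {ν : Measure E} {w : E → ℝ≥0∞}
    {m b : E} (σ : E ≃ₗᵢ[ℝ] E) (hν : MeasurePreserving (fun y => m + σ (y - m)) ν ν)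
    (hw : Measurable w) (hwσ : ∀ y, w (m + σ (y - m)) = w y) (hσ : σ (m - b) = -(m - b)) :
    ∫⁻ y, w y * ‖y - b‖ₑ ^ 2 ∂ν =
      (∫⁻ y, w y ∂ν) * ‖m - b‖ₑ ^ 2 + ∫⁻ y, w y * ‖y - m‖ₑ ^ 2 ∂ν := by
  have h_norm_reflected (y : E) : ‖m + σ (y - m) - b‖ₑ = ‖(m - b) - (y - m)‖ₑ := by
    have h_image : m + σ (y - m) - b = σ ((y - m) - (m - b)) := by
      rw [map_sub σ (y - m), hσ]
      abel
    rw [h_image, LinearIsometryEquiv.enorm_map, enorm_sub_rev]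
  have h_reflected : ∫⁻ y, w y * ‖y - b‖ₑ ^ 2 ∂ν =
      ∫⁻ y, w y * ‖(m - b) - (y - m)‖ₑ ^ 2 ∂ν := by
    rw [← hν.lintegral_comp (by fun_prop)]
    simp only [hwσ, h_norm_reflected]
  have h_average (y : E) : w y * ‖y - b‖ₑ ^ 2 + w y * ‖(m - b) - (y - m)‖ₑ ^ 2 =
      2 * (w y * ‖m - b‖ₑ ^ 2 + w y * ‖y - m‖ₑ ^ 2) := by
    rw [← mul_add, ← mul_add, mul_left_comm, ← enorm_add_sq_add_enorm_sub_sq, add_comm (m - b),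
      sub_add_sub_cancel]
  refine (ENNReal.mul_right_inj two_ne_zero ENNReal.ofNat_ne_top).1 ?_
  rw [two_mul]
  nth_rw 2 [h_reflected]
  rw [← lintegral_add_left (by fun_prop), ← lintegral_mul_const _ hw,
    ← lintegral_add_left (by fun_prop), ← lintegral_const_mul _ (by fun_prop)]
  exact lintegral_congr h_average

end InnerProductSpace

section IsotropicGaussian

variable {E : Type*} [NormedAddCommGroup E] [InnerProductSpace ℝ E] [FiniteDimensional ℝ E]

lemma exists_orthonormalBasis_inl_mem (U : Submodule ℝ E) :
    ∃ b : OrthonormalBasis (Fin (Module.finrank ℝ U) ⊕ Fin (Module.finrank ℝ Uᗮ)) ℝ E,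
      ∀ i, b (Sum.inl i) ∈ U :=
  ⟨((stdOrthonormalBasis ℝ U).prod (stdOrthonormalBasis ℝ Uᗮ)).map U.orthogonalDecomposition.symm,
    fun i => by simp⟩

lemma abs_le_norm_starProjection_sum {ι : Type*} [Fintype ι] (b : OrthonormalBasis ι ℝ E)
    {U : Submodule ℝ E} {i : ι} (hi : b i ∈ U) (c : ι → ℝ) :
    |c i| ≤ ‖U.starProjection (∑ j, c j • b j)‖ := by
  calc |c i| = |inner ℝ (b i) (U.starProjection (∑ j, c j • b j))| := by
        rw [← U.inner_starProjection_left_eq_right, U.starProjection_eq_self_iff.2 hi,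
          b.orthonormal.inner_right_fintype]
    _ ≤ ‖U.starProjection (∑ j, c j • b j)‖ := by
        simpa using abs_real_inner_le_norm (b i) (U.starProjection (∑ j, c j • b j))

/- Spreading `‖P z‖ ^ (-r)` evenly over the `d` coordinates of `z` in `U` leaves each with the
exponent `-r / d`, which is above `-1`, hence Gaussian-integrable, when `r < d`. -/
lemma norm_starProjection_rpow_neg_mul_norm_pow_le {ι ι' : Type*} [Fintype ι] [Fintype ι']
    [Nonempty ι] (b : OrthonormalBasis (ι ⊕ ι') ℝ E) {U : Submodule ℝ E}
    (hb : ∀ i, b (Sum.inl i) ∈ U) {r : ℝ} (hr : 0 ≤ r) (j : ℕ) {c : ι ⊕ ι' → ℝ}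
    (hc : ∀ i, c i ≠ 0) :
    ‖U.starProjection (∑ i, c i • b i)‖ ^ (-r) * ‖∑ i, c i • b i‖ ^ j ≤
      ∏ i, |c i| ^ (Sum.elim (fun _ => -(r / Fintype.card ι)) 0 i : ℝ) * (1 + c i ^ 2) ^ j := by
  set z := ∑ i, c i • b i with hz
  have h_split : ‖U.starProjection z‖ ^ (-r) =
      ∏ _i : ι, ‖U.starProjection z‖ ^ (-(r / Fintype.card ι)) := by
    rw [Finset.prod_const, ← Real.rpow_mul_natCast (norm_nonneg _), Finset.card_univ, neg_mul,
      div_mul_cancel₀ _ (by positivity)]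
  have h_proj : ‖U.starProjection z‖ ^ (-r) ≤
      ∏ i, |c i| ^ (Sum.elim (fun _ => -(r / Fintype.card ι)) 0 i : ℝ) := by
    rw [h_split, Fintype.prod_sum_type]
    simp only [Sum.elim_inl, Sum.elim_inr, Pi.zero_apply, Real.rpow_zero, Finset.prod_const_one,
      mul_one]
    refine Finset.prod_le_prod (fun _ _ => by positivity) fun i _ => ?_
    exact Real.rpow_le_rpow_of_nonpos (abs_pos.2 (hc _))
      (abs_le_norm_starProjection_sum b (hb i) c) (neg_nonpos.2 (by positivity))
  have h_norm_sq : ‖z‖ ^ 2 = ∑ i, c i ^ 2 := by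
    rw [← b.sum_sq_inner_right]
    exact Finset.sum_congr rfl fun i _ => by rw [hz, b.orthonormal.inner_right_fintype]
  have h_norm : ‖z‖ ^ j ≤ ∏ i, (1 + c i ^ 2) ^ j := by
    calc ‖z‖ ^ j ≤ (1 + ‖z‖ ^ 2) ^ j := by
          gcongr
          nlinarith [sq_nonneg (‖z‖ - 1)]
      _ ≤ (∏ i, (1 + c i ^ 2)) ^ j := by
          gcongr
          rw [h_norm_sq]
          exact one_add_sum_sq_le_prod_one_add_sq _ c
      _ = ∏ i, (1 + c i ^ 2) ^ j := (Finset.prod_pow _ _ _).symm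
  rw [Finset.prod_mul_distrib]
  gcongr

variable [MeasurableSpace E] [BorelSpace E]

lemma ae_stdGaussian_starProjection_ne_zero {U : Submodule ℝ E} (hU : 0 < Module.finrank ℝ U) :
    ∀ᵐ z ∂stdGaussian E, U.starProjection z ≠ 0 := by
  obtain ⟨b, hb⟩ := exists_orthonormalBasis_inl_mem U
  have h_meas : MeasurableSet {z : E | U.starProjection z ≠ 0} :=
    (measurableSet_eq_fun (by fun_prop) measurable_const).compl
  rw [stdGaussian_eq_map_pi_orthonormalBasis b,
    ae_map_iff (Measurable.aemeasurable (by fun_prop)) h_meas]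
  filter_upwards [ae_pi_gaussianReal_ne_zero _ one_ne_zero] with c hc
  exact norm_pos_iff.1 <|
    (abs_pos.2 (hc _)).trans_le (abs_le_norm_starProjection_sum b (hb ⟨0, hU⟩) c)

lemma integrable_norm_starProjection_rpow_neg_mul_norm_pow_stdGaussian {U : Submodule ℝ E} {r : ℝ}
    (hr : 0 ≤ r) (hrU : r < Module.finrank ℝ U) (j : ℕ) :
    Integrable (fun z => ‖U.starProjection z‖ ^ (-r) * ‖z‖ ^ j) (stdGaussian E) := by
  obtain ⟨b, hb⟩ := exists_orthonormalBasis_inl_mem U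
  have hU_pos : (0 : ℝ) < Module.finrank ℝ U := hr.trans_lt hrU
  have : NeZero (Module.finrank ℝ U) := ⟨by exact_mod_cast hU_pos.ne'⟩
  rw [stdGaussian_eq_map_pi_orthonormalBasis b,
    integrable_map_measure (Measurable.aestronglyMeasurable (by fun_prop))
      (Measurable.aemeasurable (by fun_prop))]
  refine (Integrable.fintype_prod fun i =>
    integrable_abs_rpow_mul_one_add_sq_pow_gaussianReal one_ne_zero j
      (r := Sum.elim (fun _ => -(r / Module.finrank ℝ U)) 0 i) ?_).mono'
    (Measurable.aestronglyMeasurable (by fun_prop)) ?_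
  · rcases i with _ | _
    · simpa [div_lt_one hU_pos] using hrU
    · simp
  · filter_upwards [ae_pi_gaussianReal_ne_zero _ one_ne_zero] with c hc
    rw [Function.comp_apply, Real.norm_of_nonneg (by positivity)]
    simpa using norm_starProjection_rpow_neg_mul_norm_pow_le b hb hr j hc

/-- The Gaussian distribution `N(m, s² I)` on a finite-dimensional inner product space, as the law
of `m + s z` for a standard Gaussian vector `z`; for `s = 0` it is the point mass at `m`. -/
noncomputable def isotropicGaussian (m : E) (s : ℝ) : Measure E :=
  (stdGaussian E).map fun z => m + s • z

instance (m : E) (s : ℝ) : IsProbabilityMeasure (isotropicGaussian m s) :=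
  Measure.isProbabilityMeasure_map (by fun_prop)

lemma measurePreserving_isotropicGaussian (m : E) (s : ℝ) (σ : E ≃ₗᵢ[ℝ] E) :
    MeasurePreserving (fun y => m + σ (y - m)) (isotropicGaussian m s) (isotropicGaussian m s) := by
  refine ⟨by fun_prop, ?_⟩
  calc (isotropicGaussian m s).map (fun y => m + σ (y - m))
      = ((stdGaussian E).map σ).map fun z => m + s • z := by
        rw [isotropicGaussian, Measure.map_map (by fun_prop) (by fun_prop),
          Measure.map_map (by fun_prop) (by fun_prop)]
        simp [Function.comp_def]
    _ = isotropicGaussian m s := by rw [stdGaussian_map, isotropicGaussian]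

lemma lintegral_isotropicGaussian_mul_enorm_sub_sq {K : Submodule ℝ E} {ω : E → ℝ≥0∞}
    (hω : Measurable ω) {m b : E} (hm : m ∈ K) (hb : b ∈ K) (s : ℝ) :
    ∫⁻ y, ω (Kᗮ.starProjection y) * ‖y - b‖ₑ ^ 2 ∂isotropicGaussian m s =
      (∫⁻ y, ω (Kᗮ.starProjection y) ∂isotropicGaussian m s) * ‖m - b‖ₑ ^ 2 +
        ∫⁻ y, ω (Kᗮ.starProjection y) * ‖y - m‖ₑ ^ 2 ∂isotropicGaussian m s := by
  have hm_proj : Kᗮ.starProjection m = 0 := K.starProjection_orthogonal_apply_eq_zero hm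
  refine lintegral_mul_enorm_sub_sq Kᗮ.reflection (measurePreserving_isotropicGaussian m s _)
    (by fun_prop) (fun y => ?_)
    (Submodule.reflection_mem_subspace_orthogonal_precomplement_eq_neg (K.sub_mem hm hb))
  rw [map_add, starProjection_reflection, map_sub, hm_proj, zero_add, sub_zero]

lemma ae_isotropicGaussian_starProjection_ne_zero {U : Submodule ℝ E}
    (hU : 0 < Module.finrank ℝ U) {m : E} (hm : U.starProjection m = 0) {s : ℝ} (hs : s ≠ 0) :
    ∀ᵐ y ∂isotropicGaussian m s, U.starProjection y ≠ 0 := by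
  have h_meas : MeasurableSet {y : E | U.starProjection y ≠ 0} :=
    (measurableSet_eq_fun (by fun_prop) measurable_const).compl
  rw [isotropicGaussian, ae_map_iff (by fun_prop) h_meas]
  filter_upwards [ae_stdGaussian_starProjection_ne_zero hU] with z hz
  simpa [hm, hs] using hz

lemma integrable_norm_starProjection_rpow_neg_mul_norm_sub_pow {U : Submodule ℝ E} {r : ℝ}
    (hr : 0 ≤ r) (hrU : r < Module.finrank ℝ U) (j : ℕ) {m : E} (hm : U.starProjection m = 0)
    (s : ℝ) :
    Integrable (fun y => ‖U.starProjection y‖ ^ (-r) * ‖y - m‖ ^ j) (isotropicGaussian m s) := by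
  rw [isotropicGaussian, integrable_map_measure (Measurable.aestronglyMeasurable (by fun_prop))
    (by fun_prop)]
  refine ((integrable_norm_starProjection_rpow_neg_mul_norm_pow_stdGaussian hr hrU j).const_mul
    (|s| ^ (-r) * |s| ^ j)).congr (ae_of_all _ fun z => ?_)
  simp only [Function.comp_apply, map_add, map_smul, hm, zero_add, add_sub_cancel_left, norm_smul,
    Real.norm_eq_abs, Real.mul_rpow (abs_nonneg s) (norm_nonneg _), mul_pow]
  ring

end IsotropicGaussian

section LeastSquares

variable {n p q : ℕ}

/-- The span of the columns of `A`, as a subspace of Euclidean space. -/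
noncomputable def columnSpace (A : Matrix (Fin n) (Fin q) ℝ) :
    Submodule ℝ (EuclideanSpace ℝ (Fin n)) :=
  LinearMap.range (Matrix.toEuclideanLin A)

lemma toLp_mulVec_mem_columnSpace (A : Matrix (Fin n) (Fin q) ℝ) (v : Fin q → ℝ) :
    WithLp.toLp 2 (A *ᵥ v) ∈ columnSpace A :=
  ⟨WithLp.toLp 2 v, rfl⟩

lemma le_add_finrank_orthogonal_columnSpace (A : Matrix (Fin n) (Fin q) ℝ) :
    n ≤ q + Module.finrank ℝ (columnSpace A)ᗮ := by
  have h_sum := (columnSpace A).finrank_add_finrank_orthogonal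
  have h_le : Module.finrank ℝ (columnSpace A) ≤ Module.finrank ℝ (EuclideanSpace ℝ (Fin q)) :=
    LinearMap.finrank_range_le _
  simp only [finrank_euclideanSpace, Fintype.card_fin] at h_sum h_le
  omega

lemma isUnit_det_transpose_mul_self_iff {A : Matrix (Fin n) (Fin q) ℝ} :
    IsUnit (Aᵀ * A).det ↔ Function.Injective A.mulVec := by
  rw [← Matrix.isUnit_iff_isUnit_det, ← Matrix.mulVec_injective_iff_isUnit,
    ← Matrix.coe_mulVecLin, ← Matrix.coe_mulVecLin, ← LinearMap.ker_eq_bot, ← LinearMap.ker_eq_bot,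
    Matrix.ker_mulVecLin_transpose_mul_self]

lemma starProjection_columnSpace {A : Matrix (Fin n) (Fin q) ℝ} (hA : IsUnit (Aᵀ * A).det)
    (y : EuclideanSpace ℝ (Fin n)) :
    (columnSpace A).starProjection y = WithLp.toLp 2 (hatMatrix A *ᵥ y.ofLp) := by
  have h_normal_equations : Aᵀ *ᵥ (y.ofLp - hatMatrix A *ᵥ y.ofLp) = 0 := by
    rw [Matrix.mulVec_sub, Matrix.mulVec_mulVec, hatMatrix, ← Matrix.mul_assoc,
      ← Matrix.mul_assoc, Matrix.mul_nonsing_inv _ hA, Matrix.one_mul, sub_self]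
  refine Submodule.eq_starProjection_of_mem_of_inner_eq_zero ?_ ?_
  · rw [hatMatrix, Matrix.mul_assoc, ← Matrix.mulVec_mulVec]
    exact toLp_mulVec_mem_columnSpace _ _
  · rintro - ⟨v, rfl⟩
    rw [EuclideanSpace.inner_eq_star_dotProduct]
    change (A *ᵥ v.ofLp) ⬝ᵥ (y.ofLp - hatMatrix A *ᵥ y.ofLp) = 0
    rw [dotProduct_comm, Matrix.dotProduct_mulVec, ← Matrix.mulVec_transpose, h_normal_equations,
      zero_dotProduct]

lemma quadForm_one_sub_hatMatrix {A : Matrix (Fin n) (Fin q) ℝ} (hA : IsUnit (Aᵀ * A).det)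
    (y : EuclideanSpace ℝ (Fin n)) :
    y.ofLp ⬝ᵥ ((1 - hatMatrix A) *ᵥ y.ofLp) = ‖(columnSpace A)ᗮ.starProjection y‖ ^ 2 := by
  have h_proj : (columnSpace A)ᗮ.starProjection y =
      WithLp.toLp 2 ((1 - hatMatrix A) *ᵥ y.ofLp) := by
    rw [Submodule.starProjection_orthogonal_val, starProjection_columnSpace hA, Matrix.sub_mulVec,
      Matrix.one_mulVec, WithLp.toLp_sub]
  have h_inner : inner ℝ ((columnSpace A)ᗮ.starProjection y) y =
      ‖(columnSpace A)ᗮ.starProjection y‖ ^ 2 := by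
    rw [← real_inner_self_eq_norm_sq, Submodule.inner_starProjection_left_eq_right,
      Submodule.inner_starProjection_left_eq_right,
      Submodule.starProjection_eq_self_iff.2 (Submodule.starProjection_apply_mem _ _)]
  rw [← h_inner, h_proj, EuclideanSpace.inner_eq_star_dotProduct, star_trivial]

lemma toLp_mulVec_projectedMean {F : Matrix (Fin n) (Fin p) ℝ} (hF : IsUnit (Fᵀ * F).det)
    (m : Fin n → ℝ) :
    WithLp.toLp 2 (F *ᵥ projectedMean F m) = (columnSpace F).starProjection (WithLp.toLp 2 m) := by
  rw [starProjection_columnSpace hF, projectedMean, Matrix.mulVec_mulVec, hatMatrix,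
    Matrix.mul_assoc]

lemma norm_sub_mulVec_projectedMean_lt {F : Matrix (Fin n) (Fin p) ℝ} (hF : IsUnit (Fᵀ * F).det)
    {m : Fin n → ℝ} {t : Fin p → ℝ} (ht : t ≠ projectedMean F m) :
    ‖WithLp.toLp 2 m - WithLp.toLp 2 (F *ᵥ projectedMean F m)‖ <
      ‖WithLp.toLp 2 m - WithLp.toLp 2 (F *ᵥ t)‖ := by
  have h_fit_ne : WithLp.toLp 2 (F *ᵥ t) ≠ WithLp.toLp 2 (F *ᵥ projectedMean F m) := fun h =>
    ht (isUnit_det_transpose_mul_self_iff.1 hF (WithLp.toLp_injective 2 h))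
  rw [toLp_mulVec_projectedMean hF] at h_fit_ne ⊢
  exact norm_sub_starProjection_lt _ (toLp_mulVec_mem_columnSpace F t) h_fit_ne

open scoped MatrixOrder in
lemma multivariateGaussian_smul_one (m : EuclideanSpace ℝ (Fin n)) {κ : ℝ} (hκ : 0 ≤ κ) :
    multivariateGaussian m (κ • (1 : Matrix (Fin n) (Fin n) ℝ)) = isotropicGaussian m √κ := by
  have h_sqrt : CFC.sqrt (κ • (1 : Matrix (Fin n) (Fin n) ℝ)) = √κ • 1 := by
    refine CFC.sqrt_unique ?_ (smul_nonneg (Real.sqrt_nonneg κ) zero_le_one)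
    rw [smul_mul_smul_comm, Real.mul_self_sqrt hκ, mul_one]
  simp [multivariateGaussian, isotropicGaussian, h_sqrt]

end LeastSquares

section ResidualWeight

variable {n p q : ℕ}

/-- The weight `1 / (2 σ̃²)`, where `σ̃² = yᵀ (I - H_A) y / (n - q)` is the residual variance of
`y` in the linear model with design matrix `A`; it is `calibrationWeight` for a general `A`. -/
noncomputable def residualWeight (A : Matrix (Fin n) (Fin q) ℝ) (y : EuclideanSpace ℝ (Fin n)) :
    ℝ :=
  1 / (2 * ((1 / ((n : ℝ) - (q : ℝ))) * (y.ofLp ⬝ᵥ ((1 - hatMatrix A) *ᵥ y.ofLp))))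

/-- The sum of squares of `y - F t`; it is `ssLoss` for a general model matrix `F`. -/
def residualSumSq (F : Matrix (Fin n) (Fin p) ℝ) (t : Fin p → ℝ) (y : EuclideanSpace ℝ (Fin n)) :
    ℝ :=
  ∑ i, (y i - (F *ᵥ t) i) ^ 2

lemma residualWeight_nonneg {A : Matrix (Fin n) (Fin q) ℝ} (hq : q ≤ n)
    (y : EuclideanSpace ℝ (Fin n)) : 0 ≤ residualWeight A y := by
  have h_dof : (0 : ℝ) ≤ n - q := sub_nonneg.2 (by exact_mod_cast hq)
  have h_quadForm := quadForm_one_sub_hatMatrix_nonneg A y.ofLp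
  rw [residualWeight]
  positivity

lemma residualWeight_eq {A : Matrix (Fin n) (Fin q) ℝ} (hA : IsUnit (Aᵀ * A).det)
    (y : EuclideanSpace ℝ (Fin n)) :
    residualWeight A y =
      ((n : ℝ) - q) / 2 * ‖(columnSpace A)ᗮ.starProjection y‖ ^ (-2 : ℝ) := by
  rw [residualWeight, quadForm_one_sub_hatMatrix hA, Real.rpow_neg (norm_nonneg _), Real.rpow_two]
  field_simp

lemma residualSumSq_eq_norm_sq (F : Matrix (Fin n) (Fin p) ℝ) (t : Fin p → ℝ)
    (y : EuclideanSpace ℝ (Fin n)) :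
    residualSumSq F t y = ‖y - WithLp.toLp 2 (F *ᵥ t)‖ ^ 2 := by
  rw [EuclideanSpace.real_norm_sq_eq]
  rfl

variable {A : Matrix (Fin n) (Fin q) ℝ} {m : EuclideanSpace ℝ (Fin n)}

lemma expectedLoss_residualWeight_residualSumSq (hA : IsUnit (Aᵀ * A).det) (hq : q ≤ n)
    {F : Matrix (Fin n) (Fin p) ℝ} (hFA : columnSpace F ≤ columnSpace A) (hm : m ∈ columnSpace A)
    (s : ℝ) (t : Fin p → ℝ) :
    expectedLoss (isotropicGaussian m s) (residualWeight A) (residualSumSq F) t =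
      (∫⁻ y, ENNReal.ofReal (residualWeight A y) ∂isotropicGaussian m s) *
          ‖m - WithLp.toLp 2 (F *ᵥ t)‖ₑ ^ 2 +
        ∫⁻ y, ENNReal.ofReal (residualWeight A y) * ‖y - m‖ₑ ^ 2 ∂isotropicGaussian m s := by
  have h_integrand (y : EuclideanSpace ℝ (Fin n)) :
      ENNReal.ofReal (residualWeight A y * residualSumSq F t y) =
        ENNReal.ofReal (residualWeight A y) * ‖y - WithLp.toLp 2 (F *ᵥ t)‖ₑ ^ 2 := by
    rw [ENNReal.ofReal_mul (residualWeight_nonneg hq y), residualSumSq_eq_norm_sq,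
      ENNReal.ofReal_pow (norm_nonneg _), ofReal_norm]
  simp only [expectedLoss, h_integrand]
  simp only [residualWeight_eq hA]
  exact lintegral_isotropicGaussian_mul_enorm_sub_sq
    (ω := fun v => ENNReal.ofReal (((n : ℝ) - q) / 2 * ‖v‖ ^ (-2 : ℝ))) (by fun_prop) hm
    (hFA (toLp_mulVec_mem_columnSpace F t)) s

lemma lintegral_residualWeight_ne_zero (hA : IsUnit (Aᵀ * A).det) (hq : q < n)
    (hm : m ∈ columnSpace A) {s : ℝ} (hs : s ≠ 0) :
    ∫⁻ y, ENNReal.ofReal (residualWeight A y) ∂isotropicGaussian m s ≠ 0 := by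
  have h_dof : (0 : ℝ) < n - q := sub_pos.2 (by exact_mod_cast hq)
  have h_finrank : 0 < Module.finrank ℝ (columnSpace A)ᗮ := by
    have := le_add_finrank_orthogonal_columnSpace A
    omega
  have h_meas : Measurable fun y => ENNReal.ofReal (residualWeight A y) := by
    simp only [residualWeight_eq hA]
    fun_prop
  intro h_zero
  obtain ⟨y, hy_zero, hy_ne⟩ := (((lintegral_eq_zero_iff h_meas).1 h_zero).and
    (ae_isotropicGaussian_starProjection_ne_zero h_finrank
      (Submodule.starProjection_orthogonal_apply_eq_zero hm) hs)).exists
  have h_norm : 0 < ‖(columnSpace A)ᗮ.starProjection y‖ := norm_pos_iff.2 hy_ne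
  refine (ENNReal.ofReal_pos.2 ?_).ne' hy_zero
  rw [residualWeight_eq hA]
  exact mul_pos (half_pos h_dof) (Real.rpow_pos_of_pos h_norm _)

lemma lintegral_residualWeight_mul_enorm_sub_pow_lt_top (hA : IsUnit (Aᵀ * A).det)
    (hq : q + 2 < n) (hm : m ∈ columnSpace A) (s : ℝ) (j : ℕ) :
    ∫⁻ y, ENNReal.ofReal (residualWeight A y) * ‖y - m‖ₑ ^ j ∂isotropicGaussian m s < ∞ := by
  have h_finrank : (2 : ℝ) < Module.finrank ℝ (columnSpace A)ᗮ := by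
    have := le_add_finrank_orthogonal_columnSpace A
    exact_mod_cast (by omega : 2 < Module.finrank ℝ (columnSpace A)ᗮ)
  have h_integrable := (integrable_norm_starProjection_rpow_neg_mul_norm_sub_pow zero_le_two
    h_finrank j (Submodule.starProjection_orthogonal_apply_eq_zero hm) s).const_mul
      (((n : ℝ) - q) / 2)
  convert h_integrable.lintegral_lt_top using 2 with y
  funext y
  rw [← mul_assoc, ← residualWeight_eq hA, ENNReal.ofReal_mul (residualWeight_nonneg (by omega) y),
    ENNReal.ofReal_pow (norm_nonneg _), ofReal_norm]

end ResidualWeight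

section Treatments

variable {k n p q : ℕ} {x : Fin n → Treatment k} {xbar : Fin q → Treatment k}

lemma treatmentMatrix_mulVec (hxbar : IsUniqueTreatments x xbar) (g : Treatment k → ℝ) :
    (treatmentMatrix x xbar *ᵥ fun j => g (xbar j)) = fun i => g (x i) := by
  classical
  funext i
  obtain ⟨j, hj⟩ : x i ∈ Set.range xbar := hxbar.range_eq ▸ Set.mem_range_self i
  simp [treatmentMatrix, Matrix.mulVec, dotProduct, ← hj, hxbar.injective.eq_iff]

lemma isUnit_det_transpose_treatmentMatrix_mul_self (hxbar : IsUniqueTreatments x xbar) :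
    IsUnit ((treatmentMatrix x xbar)ᵀ * treatmentMatrix x xbar).det := by
  refine isUnit_det_transpose_mul_self_iff.2 fun u v huv => ?_
  have h_extend (c : Fin q → ℝ) : c = fun j => Function.extend xbar c 0 (xbar j) :=
    funext fun j => (hxbar.injective.extend_apply c 0 j).symm
  rw [h_extend u, h_extend v] at huv ⊢
  rw [treatmentMatrix_mulVec hxbar, treatmentMatrix_mulVec hxbar] at huv
  funext j
  obtain ⟨i, hi⟩ : xbar j ∈ Set.range x := hxbar.range_eq ▸ Set.mem_range_self j
  simpa only [hi] using congrFun huv i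

lemma columnSpace_modelMatrix_le (hxbar : IsUniqueTreatments x xbar)
    (f : Treatment k → Fin p → ℝ) :
    columnSpace (modelMatrix f x) ≤ columnSpace (treatmentMatrix x xbar) := by
  rintro - ⟨t, rfl⟩
  have h_fit : modelMatrix f x *ᵥ t.ofLp =
      treatmentMatrix x xbar *ᵥ fun j => f (xbar j) ⬝ᵥ t.ofLp :=
    (treatmentMatrix_mulVec hxbar fun w => f w ⬝ᵥ t.ofLp).symm
  rw [Matrix.toLpLin_apply, h_fit]
  exact toLp_mulVec_mem_columnSpace _ _

end Treatments

end GibbsDesign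

open GibbsDesign in
theorem mainTheorem2_general {n p q : ℕ}
    {A : Matrix (Fin n) (Fin q) ℝ} (hA : IsUnit (Aᵀ * A).det) (hq : q < n)
    {F : Matrix (Fin n) (Fin p) ℝ} (hF : IsUnit (Fᵀ * F).det)
    (hFA : columnSpace F ≤ columnSpace A)
    (β : Fin q → ℝ) {κ : ℝ} (hκ : 0 < κ) :
    projectedMean F (A *ᵥ β) ∈
        targetValues (multivariateGaussian (WithLp.toLp 2 (A *ᵥ β)) (κ • 1))
          (residualWeight A) (residualSumSq F) ∧
      (q + 2 < n →
        (∀ t : Fin p → ℝ,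
          expectedLoss (multivariateGaussian (WithLp.toLp 2 (A *ᵥ β)) (κ • 1))
            (residualWeight A) (residualSumSq F) t < ∞) ∧
        targetValues (multivariateGaussian (WithLp.toLp 2 (A *ᵥ β)) (κ • 1))
            (residualWeight A) (residualSumSq F) =
          {projectedMean F (A *ᵥ β)}) := by
  have hm := toLp_mulVec_mem_columnSpace A β
  set θ := projectedMean F (A *ᵥ β)
  rw [multivariateGaussian_smul_one _ hκ.le]
  have h_loss := expectedLoss_residualWeight_residualSumSq hA hq.le hFA hm √κ
  have h_closer {t : Fin p → ℝ} (ht : t ≠ θ) :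
      ‖WithLp.toLp 2 (A *ᵥ β) - WithLp.toLp 2 (F *ᵥ θ)‖ₑ <
        ‖WithLp.toLp 2 (A *ᵥ β) - WithLp.toLp 2 (F *ᵥ t)‖ₑ :=
    ENNReal.coe_lt_coe.2 (norm_sub_mulVec_projectedMean_lt hF ht)
  have h_mem : θ ∈ targetValues _ _ _ := fun t => by
    rcases eq_or_ne t θ with rfl | ht
    · exact le_rfl
    · rw [h_loss, h_loss]
      gcongr
      exact (h_closer ht).le
  refine ⟨h_mem, fun hn => ?_⟩
  have h_moment := lintegral_residualWeight_mul_enorm_sub_pow_lt_top hA hn hm √κ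
  have h_weight_ne_top := (h_moment 0).ne
  simp only [pow_zero, mul_one] at h_weight_ne_top
  refine ⟨fun t => ?_, Set.eq_singleton_iff_unique_mem.2 ⟨h_mem, fun t ht => ?_⟩⟩
  · rw [h_loss]
    exact ENNReal.add_lt_top.2 ⟨by finiteness, h_moment 2⟩
  · by_contra hne
    refine (ht θ).not_gt ?_
    rw [h_loss, h_loss]
    have h_weight_ne_zero :=
      lintegral_residualWeight_ne_zero hA hq hm (Real.sqrt_pos.2 hκ).ne'
    exact ENNReal.add_lt_add_right (h_moment 2).ne (ENNReal.mul_lt_mul_right h_weight_ne_zero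
      h_weight_ne_top (ENNReal.pow_lt_pow_left two_ne_zero (h_closer hne)))

theorem mainTheorem2 {k n p q : ℕ}
    (x : Fin n → GibbsDesign.Treatment k)
    (xbar : Fin q → GibbsDesign.Treatment k)
    (hxbar : GibbsDesign.IsUniqueTreatments x xbar)
    (hq : q < n)
    (f : GibbsDesign.Treatment k → Fin p → ℝ)
    (hF : IsUnit ((GibbsDesign.modelMatrix f x)ᵀ * GibbsDesign.modelMatrix f x).det)
    (μ : GibbsDesign.Treatment k → ℝ)
    (κ : ℝ) (hκ : 0 < κ) :
    GibbsDesign.projectedMean (GibbsDesign.modelMatrix f x) (fun i => μ (x i)) ∈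
        GibbsDesign.targetValues (GibbsDesign.designerDistribution x xbar μ κ)
          (GibbsDesign.calibrationWeight x xbar) (GibbsDesign.ssLoss f x) ∧
      (q + 2 < n →
        (∀ t : Fin p → ℝ,
          GibbsDesign.expectedLoss (GibbsDesign.designerDistribution x xbar μ κ)
            (GibbsDesign.calibrationWeight x xbar) (GibbsDesign.ssLoss f x) t < ∞) ∧
        GibbsDesign.targetValues (GibbsDesign.designerDistribution x xbar μ κ)
            (GibbsDesign.calibrationWeight x xbar) (GibbsDesign.ssLoss f x) =
          {GibbsDesign.projectedMean (GibbsDesign.modelMatrix f x) (fun i => μ (x i))}) := by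
  rw [← GibbsDesign.treatmentMatrix_mulVec hxbar μ]
  exact mainTheorem2_general
    (GibbsDesign.isUnit_det_transpose_treatmentMatrix_mul_self hxbar) hq hF
    (GibbsDesign.columnSpace_modelMatrix_le hxbar f) (fun j => μ (xbar j)) hκ
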